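/- For a finite set $X$, let $T(X)$ be the semigroup of all functions $X\to X$ under composition. For a finite non-commutative semigroup $S$ with center $Z(S)$, the commuting graph $\mathcal{G}(S)$ is the simple graph with vertex set $S\setminus Z(S)$ in which two vertices $a,b$ are adjacent if and only if $a\neq b$ and $ab=ba$. The diameter of a graph is the maximum of the distances $d(u,w)$ (lengths of shortest paths) over all vertices $u,w$, where $d(u,w)=\infty$ if there is no path from $u$ to $w$. Theorem. Let $X$ be a finite set with $n\geq 2$ elements. Then: (1) If $n$ is prime, then $\mathcal{G}(T(X))$ is not connected. (2) If $n=4$, then the diameter of $\mathcal{G}(T(X))$ is $4$. (3) If $n\geq 6$ is composite, then the diameter of $\mathcal{G}(T(X))$ is $5$. -/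

import Mathlib

/-- The commuting graph `𝒢(S)` of a semigroup `S`: its vertices are the elements of `S` that are
not in the center `Z(S)`, and two vertices `a`, `b` are adjacent if and only if `a ≠ b` and
`a * b = b * a`. -/
def commutingGraph (S : Type*) [Semigroup S] :
    SimpleGraph {a : S // a ∉ Subsemigroup.center S} where
  Adj a b := a ≠ b ∧ (a : S) * (b : S) = (b : S) * (a : S)
  symm := ⟨fun _ _ h => ⟨h.1.symm, h.2.symm⟩⟩
  loopless := ⟨fun _ h => h.1 rfl⟩

/-- The full transformation semigroup `T(X)`: all functions from `X` to `X`, multiplied by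
composition (the two orders of composition have the same commuting pairs, hence the same
commuting graph). -/
abbrev FullTransformation (X : Type*) : Type _ := Function.End X

/-! Only the identity commutes with all constants, so the center is trivial and the diameter is a
question about chains of non-identity maps. Upper bound 5: a map other than 1 commutes with an
idempotent, or with a non-identity permutation that fixes a point and whose centralizer can fix any
prescribed point, or is an `n`-cycle (`trichotomy`). Outside the case of two `n`-cycles, a constant
joins the two sides. Two `n`-cycles are replaced by their powers `σ`, `τ` of order `p`, the least
prime factor of `n`. Either a `σ`-orbit misses a `τ`-orbit and rotations of these two orbits
commute, or the points form a `p × p` grid whose two axis projections commute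
(`exists_commuting_of_semiregular`). Lower bounds: if the forward orbit of one point under `a` is
everything, the centralizer of `a` consists of powers of `a`, and whatever commutes with a
non-identity power commutes with the idempotent power `a ^ m`
(`IsGeneratedBy.commute_idempotent_pow`). For `n ≥ 7`, two such maps are chosen whose idempotent
powers have trivial joint centralizer. For `n = 6` and `n = 4` one of the two maps is an `n`-cycle.
The upper bound for `n = 4` is a finite check. For prime `n`, non-identity powers of an `n`-cycle
have the same centralizer as the cycle, so no chain leaves its powers. -/

/-- A chain of `k` steps from `a` to `b` through elements other than `1`, in which consecutive
elements commute (and may coincide). -/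
def CommutingChain {M : Type*} [Monoid M] : ℕ → M → M → Prop
  | 0, a, b => a = b
  | k + 1, a, b => ∃ c, c ≠ 1 ∧ Commute a c ∧ CommutingChain k c b

/-! ### Distances in the commuting graph as commuting chains -/

section Chain

variable {M N : Type*} [Monoid M] [Monoid N]

theorem CommutingChain.refl {a : M} (ha : a ≠ 1) (k : ℕ) : CommutingChain k a a := by
  induction k with
  | zero => rfl
  | succ k ih => exact ⟨a, ha, Commute.refl a, ih⟩

theorem CommutingChain.map (φ : M ≃* N) {k : ℕ} {a b : M} (h : CommutingChain k a b) :
    CommutingChain k (φ a) (φ b) := by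
  induction k generalizing a with
  | zero => exact congrArg φ h
  | succ k ih =>
    obtain ⟨c, hc, hac, h⟩ := h
    exact ⟨φ c, by simpa using hc, hac.map φ, ih h⟩

theorem CommutingChain.snoc {k : ℕ} {a b c : M} (h : CommutingChain k a b) (hc : c ≠ 1)
    (hbc : Commute b c) : CommutingChain (k + 1) a c := by
  induction k generalizing a with
  | zero => cases h; exact ⟨c, hc, hbc, rfl⟩
  | succ k ih =>
    obtain ⟨d, hd, had, h⟩ := h
    exact ⟨d, hd, had, ih h⟩

theorem CommutingChain.symm {k : ℕ} {a b : M} (ha : a ≠ 1) (h : CommutingChain k a b) :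
    CommutingChain k b a := by
  induction k generalizing a with
  | zero => exact Eq.symm h
  | succ k ih =>
    obtain ⟨c, hc, hac, h⟩ := h
    exact (ih hc h).snoc ha hac.symm

theorem commutingChain_of_walk {u v : {a : M // a ∉ Subsemigroup.center M}}
    (hM : ∀ a : M, a ∈ Subsemigroup.center M ↔ a = 1)
    (p : (commutingGraph M).Walk u v) {k : ℕ} (hk : p.length ≤ k) :
    CommutingChain k (u : M) (v : M) := by
  induction p generalizing k with
  | @nil u => exact CommutingChain.refl (fun h => u.2 ((hM _).2 h)) k
  | @cons u w v h p ih =>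
    rw [SimpleGraph.Walk.length_cons] at hk
    obtain ⟨k, rfl⟩ : ∃ l, k = l + 1 := ⟨k - 1, by omega⟩
    exact ⟨w, fun h => w.2 ((hM _).2 h), h.2, ih (by omega)⟩

theorem edist_le_of_commutingChain (hM : ∀ a : M, a ∈ Subsemigroup.center M ↔ a = 1) {k : ℕ}
    {u v : {a : M // a ∉ Subsemigroup.center M}} (h : CommutingChain k (u : M) (v : M)) :
    (commutingGraph M).edist u v ≤ k := by
  induction k generalizing u with
  | zero => simp [Subtype.ext h]
  | succ k ih =>
    obtain ⟨c, hc, hac, h⟩ := h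
    let w : {a : M // a ∉ Subsemigroup.center M} := ⟨c, fun h => hc ((hM c).1 h)⟩
    have h1 : (commutingGraph M).edist u w ≤ 1 := by
      rw [SimpleGraph.edist_le_one_iff_adj_or_eq]
      by_cases huw : u = w
      · exact Or.inr huw
      · exact Or.inl ⟨huw, hac⟩
    calc (commutingGraph M).edist u v
        ≤ (commutingGraph M).edist u w + (commutingGraph M).edist w v :=
          SimpleGraph.edist_triangle
      _ ≤ 1 + k := add_le_add h1 (ih (u := w) h)
      _ = ((k + 1 : ℕ) : ℕ∞) := by push_cast; rw [add_comm]

theorem ediam_commutingGraph_le_iff (hM : ∀ a : M, a ∈ Subsemigroup.center M ↔ a = 1) (k : ℕ) :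
    (commutingGraph M).ediam ≤ k ↔
      ∀ a b : M, a ≠ 1 → b ≠ 1 → CommutingChain k a b := by
  rw [SimpleGraph.ediam_le_iff]
  constructor
  · intro h a b ha hb
    have h' := h ⟨a, fun h => ha ((hM a).1 h)⟩ ⟨b, fun h => hb ((hM b).1 h)⟩
    obtain ⟨p, hp⟩ := SimpleGraph.exists_walk_of_edist_ne_top
      (ne_top_of_le_ne_top (ENat.natCast_ne_top k) h')
    rw [← hp] at h'
    exact commutingChain_of_walk hM p (by exact_mod_cast h')
  · intro h u v
    exact edist_le_of_commutingChain hM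
      (h u v (fun h => u.2 ((hM _).2 h)) (fun h => v.2 ((hM _).2 h)))

end Chain

/-! ### Constants, the center, and maps generated by one point -/

section End

variable {X : Type*}

theorem Function.End.commute_iff {a b : Function.End X} :
    Commute a b ↔ ∀ x, a (b x) = b (a x) :=
  ⟨fun h x => congrFun h x, fun h => funext h⟩

theorem Function.End.ne_one_of_apply_ne {a : Function.End X} {x : X} (h : a x ≠ x) : a ≠ 1 :=
  fun h1 => h (congrFun h1 x)

theorem Function.End.exists_apply_ne {a : Function.End X} (h : a ≠ 1) : ∃ x, a x ≠ x := by
  by_contra! hx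
  exact h (funext hx)

/-- The constant transformation with value `x`. -/
def constEnd (x : X) : Function.End X := fun _ => x

theorem commute_constEnd {a : Function.End X} {x : X} (h : a x = x) : Commute a (constEnd x) :=
  Function.End.commute_iff.2 fun _ => h

theorem apply_eq_of_commute_constEnd {a : Function.End X} {x : X}
    (h : Commute a (constEnd x)) : a x = x :=
  Function.End.commute_iff.1 h x

theorem constEnd_ne_one [Nontrivial X] (x : X) : constEnd x ≠ 1 := by
  obtain ⟨y, hy⟩ := exists_ne x
  exact Function.End.ne_one_of_apply_ne (x := y) hy.symm

theorem mem_center_end_iff (a : Function.End X) :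
    a ∈ Subsemigroup.center (Function.End X) ↔ a = 1 := by
  rw [Subsemigroup.mem_center_iff]
  constructor
  · intro h
    exact funext fun x => apply_eq_of_commute_constEnd (h (constEnd x)).symm
  · rintro rfl g
    simp

/-- Transport of transformations along a bijection. -/
def endCongr {Y : Type*} (u : X ≃ Y) : Function.End X ≃* Function.End Y where
  toFun a := fun y => u (a (u.symm y))
  invFun b := fun x => u.symm (b (u x))
  left_inv a := funext fun x => by simp
  right_inv b := funext fun x => by simp
  map_mul' a b := funext fun x => by
    change u (a (b _)) = u (a (u.symm (u (b _))))
    simp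

theorem endCongr_apply {Y : Type*} (u : X ≃ Y) (a : Function.End X) (y : Y) :
    endCongr u a y = u (a (u.symm y)) := rfl

/-- `a` is generated by `x` when the forward orbit of `x` under `a` is everything. -/
def IsGeneratedBy (a : Function.End X) (x : X) : Prop := ∀ z, ∃ i : ℕ, (a ^ i) x = z

theorem IsGeneratedBy.conj {Y : Type*} {a : Function.End X} {x : X} (h : IsGeneratedBy a x)
    (u : X ≃ Y) : IsGeneratedBy (endCongr u a) (u x) := by
  intro z
  obtain ⟨i, hi⟩ := h (u.symm z)
  refine ⟨i, ?_⟩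
  rw [← map_pow, endCongr_apply]
  simp [hi]

/-- A map commuting with `a` is determined by its value at the generator `x`, and that value is some
`(a ^ i) x`. -/
theorem IsGeneratedBy.exists_pow_eq {a g : Function.End X} {x : X} (h : IsGeneratedBy a x)
    (hg : Commute a g) : ∃ i : ℕ, g = a ^ i := by
  obtain ⟨i, hi⟩ := h (g x)
  refine ⟨i, funext fun z => ?_⟩
  obtain ⟨j, rfl⟩ := h z
  calc g ((a ^ j) x) = (a ^ j) (g x) :=
        (Function.End.commute_iff.1 (hg.pow_left j) x).symm
    _ = (a ^ j) ((a ^ i) x) := by rw [hi]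
    _ = (a ^ i) ((a ^ j) x) :=
        Function.End.commute_iff.1 ((Commute.refl a).pow_pow j i) x

/-- Here `g = a ^ k` with `k ≠ 0`, so `g ^ m = (a ^ m) ^ k = a ^ m` by idempotence: the idempotent
is a power of `g`. -/
theorem IsGeneratedBy.commute_idempotent_pow {a g h : Function.End X} {x : X}
    (ha : IsGeneratedBy a x) {m : ℕ} (hm : IsIdempotentElem (a ^ m)) (hg : g ≠ 1)
    (hag : Commute a g) (hgh : Commute g h) : Commute (a ^ m) h := by
  obtain ⟨k, rfl⟩ := ha.exists_pow_eq hag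
  have hk : k ≠ 0 := by
    rintro rfl
    exact hg (pow_zero a)
  have h1 : (a ^ k) ^ m = a ^ m := by
    rw [← pow_mul, mul_comm, pow_mul]
    obtain ⟨l, rfl⟩ := Nat.exists_eq_succ_of_ne_zero hk
    exact hm.pow_succ_eq l
  rw [← h1]
  exact hgh.pow_left m

end End

/-! ### Upper bound: idempotents, fixed points and the trichotomy -/

section Upper

variable {X : Type*}

open Function.End

theorem apply_apply_of_isIdempotentElem {e : Function.End X} (he : IsIdempotentElem e) (x : X) :
    e (e x) = e x :=
  congrFun he x

/-- An idempotent commutes with a transformation other than `1` that fixes a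
prescribed point, provided there are at least three points. -/
theorem exists_commute_fixing_of_isIdempotentElem (hX : ∀ x y : X, ∃ z, z ≠ x ∧ z ≠ y)
    {e : Function.End X} (he : IsIdempotentElem e) (x : X) :
    ∃ g : Function.End X, g ≠ 1 ∧ Commute e g ∧ g x = x := by
  classical
  have hee := apply_apply_of_isIdempotentElem he
  by_cases h : ∃ y, e y ≠ e x
  · obtain ⟨y, hy⟩ := h
    -- Keep the fiber of `e` through `x` pointwise and send all other points to `e x`.
    refine ⟨fun z => if e z = e x then z else e x, ?_, ?_, if_pos rfl⟩
    · refine ne_one_of_apply_ne (x := y) ?_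
      rw [if_neg hy]
      intro h
      exact hy (by rw [← h, hee])
    · refine commute_iff.2 fun z => ?_
      by_cases hz : e z = e x <;> simp [hz, hee]
  · push Not at h
    -- Now `e` is constant, so any map fixing its value commutes with it; moving one further point
    -- `w` to `x` will do.
    obtain ⟨w, hwx, hwy⟩ := hX x (e x)
    refine ⟨fun z => if z = w then x else z, ?_, ?_, ?_⟩
    · exact ne_one_of_apply_ne (x := w) (by simpa using hwx.symm)
    · refine commute_iff.2 fun z => ?_
      rw [h, h z, if_neg hwy.symm]
    · exact if_neg hwx.symm

/-- `a` commutes with an idempotent other than `1`. -/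
def CommutesWithIdempotent (a : Function.End X) : Prop :=
  ∃ e : Function.End X, e ≠ 1 ∧ IsIdempotentElem e ∧ Commute a e

/-- Every point is fixed by some transformation other than `1` that commutes with `a`. -/
def FixableEverywhere (a : Function.End X) : Prop :=
  ∀ x, ∃ f : Function.End X, f ≠ 1 ∧ Commute a f ∧ f x = x

theorem exists_apply_eq_of_isIdempotentElem [Nonempty X] {e : Function.End X}
    (he : IsIdempotentElem e) : ∃ x, e x = x :=
  ⟨e (Classical.arbitrary X), apply_apply_of_isIdempotentElem he _⟩

/-- The chain is `a, e, constEnd x, g, f, b`, where `x` is fixed by `e` and `g` fixes `x` and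
commutes with `f`. -/
theorem commutingChain_of_idempotents [Nontrivial X] (hX : ∀ x y : X, ∃ z, z ≠ x ∧ z ≠ y)
    {a b : Function.End X} (ha : CommutesWithIdempotent a) (hb : CommutesWithIdempotent b)
    (hb1 : b ≠ 1) : CommutingChain 5 a b := by
  obtain ⟨e, he1, he, hae⟩ := ha
  obtain ⟨f, hf1, hf, hbf⟩ := hb
  obtain ⟨x, hx⟩ := exists_apply_eq_of_isIdempotentElem he
  obtain ⟨g, hg1, hfg, hgx⟩ := exists_commute_fixing_of_isIdempotentElem hX hf x
  exact ⟨e, he1, hae, constEnd x, constEnd_ne_one x, commute_constEnd hx, g, hg1,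
    (commute_constEnd hgx).symm, f, hf1, hfg.symm, b, hb1, hbf.symm, rfl⟩

theorem commutingChain_of_fixed_point [Nontrivial X] {a b a' b' : Function.End X} {x : X}
    (ha' : a' ≠ 1) (haa' : Commute a a') (hx : a' x = x) (hb1 : b ≠ 1) (hb' : b' ≠ 1)
    (hbb' : Commute b b') (hfix : FixableEverywhere b') : CommutingChain 5 a b := by
  obtain ⟨g, hg1, hg, hgx⟩ := hfix x
  exact ⟨a', ha', haa', constEnd x, constEnd_ne_one x, commute_constEnd hx, g, hg1,
    (commute_constEnd hgx).symm, b', hb', hg.symm, b, hb1, hbb'.symm, rfl⟩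

/-- Moving one fixed point onto the other commutes with `a`, as injectivity keeps other points from
landing there; of the two fixed points, the one to move can be chosen different from `x`. -/
theorem fixableEverywhere_of_two_fixed {a : Function.End X} {y y' : X} (hy : a y = y)
    (hy' : a y' = y') (hne : y ≠ y') (hinj : Function.Injective a) : FixableEverywhere a := by
  classical
  have key : ∀ p q : X, a p = p → a q = q → p ≠ q → ∀ x, x ≠ p →
      ∃ f : Function.End X, f ≠ 1 ∧ Commute a f ∧ f x = x := by
    intro p q hp hq hpq x hx
    refine ⟨fun z => if z = p then q else z, ?_, ?_, if_neg hx⟩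
    · exact ne_one_of_apply_ne (x := p) (by simpa using hpq.symm)
    · refine commute_iff.2 fun z => ?_
      by_cases hz : z = p
      · simp [hz, hp, hq]
      · have : a z ≠ p := fun h => hz (hinj (h.trans hp.symm))
        simp [hz, this]
  intro x
  by_cases hx : x = y
  · exact key y' y hy' hy hne.symm x (by rw [hx]; exact hne)
  · exact key y y' hy hy' hne x hx

/-- All powers of `σ` other than `1` are free of fixed points. -/
def IsSemiregular (σ : Equiv.Perm X) : Prop := ∀ (i : ℤ) (x : X), (σ ^ i) x = x → σ ^ i = 1

theorem IsSemiregular.zpow_eq {σ : Equiv.Perm X} (h : IsSemiregular σ) {i j : ℤ} {x : X}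
    (hij : (σ ^ i) x = (σ ^ j) x) : σ ^ i = σ ^ j := by
  have h1 : σ ^ (-j + i) = 1 := by
    apply h _ x
    rw [zpow_add, Equiv.Perm.mul_apply, hij, ← Equiv.Perm.mul_apply, ← zpow_add]
    simp
  rw [zpow_add, zpow_neg] at h1
  exact (inv_mul_eq_one.1 h1).symm

/-- The permutation `σ` as an element of the full transformation monoid. -/
def Equiv.Perm.toEnd (σ : Equiv.Perm X) : Function.End X := fun x => σ x

theorem Equiv.Perm.toEnd_apply (σ : Equiv.Perm X) (x : X) : σ.toEnd x = σ x := rfl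

theorem Equiv.Perm.commute_toEnd {σ τ : Equiv.Perm X} (h : Commute σ τ) :
    Commute σ.toEnd τ.toEnd :=
  commute_iff.2 fun x => congrArg (fun ρ : Equiv.Perm X => ρ x) h

theorem Equiv.Perm.toEnd_ne_one {σ : Equiv.Perm X} (h : σ ≠ 1) : σ.toEnd ≠ 1 :=
  fun h1 => h (Equiv.ext fun x => congrFun h1 x)

/-- Collapsing the orbit of `x` onto the orbit of `y` commutes with a semiregular permutation. -/
theorem IsSemiregular.exists_collapse {σ : Equiv.Perm X} (h : IsSemiregular σ) {x y : X}
    (hxy : ¬ σ.SameCycle x y) :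
    ∃ f : Function.End X, f ≠ 1 ∧ IsIdempotentElem f ∧ Commute σ.toEnd f ∧ f y = y := by
  classical
  -- The chosen exponent is immaterial: by semiregularity, powers that agree at `x` are equal.
  let f : Function.End X := fun z => if hz : σ.SameCycle x z then (σ ^ hz.choose) y else z
  have hf : ∀ (i : ℤ), f ((σ ^ i) x) = (σ ^ i) y := by
    intro i
    have hz : σ.SameCycle x ((σ ^ i) x) := ⟨i, rfl⟩
    change (if hz : σ.SameCycle x ((σ ^ i) x) then (σ ^ hz.choose) y else _) = _
    rw [dif_pos hz, h.zpow_eq hz.choose_spec]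
  have hf' : ∀ z, ¬ σ.SameCycle x z → f z = z := fun z hz => dif_neg hz
  have hy : ∀ i : ℤ, ¬ σ.SameCycle x ((σ ^ i) y) := fun i hi =>
    hxy ((Equiv.Perm.sameCycle_zpow_right).1 hi)
  refine ⟨f, ?_, ?_, ?_, hf' y hxy⟩
  · refine ne_one_of_apply_ne (x := x) ?_
    have h0 := hf 0
    simp only [zpow_zero, Equiv.Perm.one_apply] at h0
    rw [h0]
    rintro rfl
    exact hxy (Equiv.Perm.SameCycle.refl _ _)
  · refine funext fun z => ?_
    change f (f z) = f z
    by_cases hz : σ.SameCycle x z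
    · obtain ⟨i, rfl⟩ := hz
      rw [hf, hf' _ (hy i)]
    · rw [hf' z hz, hf' z hz]
  · refine commute_iff.2 fun z => ?_
    rw [Equiv.Perm.toEnd_apply, Equiv.Perm.toEnd_apply]
    by_cases hz : σ.SameCycle x z
    · obtain ⟨i, rfl⟩ := hz
      have h1 : ∀ w, σ ((σ ^ i) w) = (σ ^ (1 + i)) w := fun w => by
        rw [zpow_one_add, Equiv.Perm.mul_apply]
      rw [hf, h1, h1, hf]
    · rw [hf' z hz, hf']
      exact fun h => hz ((Equiv.Perm.sameCycle_apply_right).1 h)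

variable [Finite X]

theorem exists_isIdempotentElem_pow (a : Function.End X) :
    ∃ m, 0 < m ∧ IsIdempotentElem (a ^ m) := by
  have : Finite (Function.End X) := inferInstanceAs (Finite (X → X))
  obtain ⟨i, j, hij, h⟩ := Set.finite_univ.exists_lt_map_eq_of_forall_mem
    (f := fun i : ℕ => a ^ i) (fun _ => Set.mem_univ _)
  obtain ⟨d, rfl⟩ := Nat.exists_eq_add_of_lt hij
  have h1 : ∀ n, i ≤ n → a ^ (n + (d + 1)) = a ^ n := by
    intro n hn
    obtain ⟨l, rfl⟩ := Nat.exists_eq_add_of_le hn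
    have h' : a ^ i = a ^ (i + d + 1) := h
    rw [pow_add a i l, h', ← pow_add]
    congr 1
    ring
  have h2 : ∀ n k, i ≤ n → a ^ (n + (d + 1) * k) = a ^ n := by
    intro n k hn
    induction k with
    | zero => simp
    | succ k ih => rw [mul_add, mul_one, ← add_assoc, h1 _ (by omega), ih]
  -- The powers have period `d + 1` from exponent `i` on; this exponent is a multiple of the period
  -- and at least `i`.
  refine ⟨(d + 1) * (i + 1), by positivity, ?_⟩
  rw [IsIdempotentElem, ← pow_add]
  exact h2 _ _ (by nlinarith [Nat.zero_le (d * i)])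

/-- Every transformation other than `1` commutes with an idempotent other than `1`, or is a
permutation with a nontrivial power fixing at least two points, or is a cyclic permutation of
all the points. -/
theorem trichotomy {a : Function.End X} (ha : a ≠ 1) :
    CommutesWithIdempotent a ∨
    (∃ (a' : Function.End X) (x : X), a' ≠ 1 ∧ Commute a a' ∧ a' x = x ∧ FixableEverywhere a') ∨
    ∃ σ : Equiv.Perm X, a = σ.toEnd ∧ ∀ x y, σ.SameCycle x y := by
  obtain ⟨x₀, hx₀⟩ := exists_apply_ne ha
  have : Nontrivial X := ⟨⟨_, _, hx₀⟩⟩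
  by_cases hbij : Function.Bijective a
  swap
  · obtain ⟨m, hm, he⟩ := exists_isIdempotentElem_pow a
    refine Or.inl ⟨a ^ m, fun h => hbij ?_, he, (Commute.refl a).pow_right m⟩
    obtain ⟨l, rfl⟩ : ∃ l, m = l + 1 := ⟨m - 1, by omega⟩
    refine Function.Injective.bijective_of_finite fun x y hxy => ?_
    have h1 : ∀ z, (a ^ l) (a z) = z := fun z => by
      rw [pow_succ] at h
      exact congrFun h z
    rw [← h1 x, hxy, h1]
  let σ : Equiv.Perm X := Equiv.ofBijective a hbij
  have hσ : a = σ.toEnd := rfl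
  have hpow : ∀ i : ℤ, Commute a (σ ^ i).toEnd := fun i =>
    Equiv.Perm.commute_toEnd ((Commute.refl σ).zpow_right i)
  by_cases hfp : ∃ x, a x = x
  · obtain ⟨x, hx⟩ := hfp
    exact Or.inl ⟨constEnd x, constEnd_ne_one x, rfl, commute_constEnd hx⟩
  push Not at hfp
  by_cases hsr : IsSemiregular σ
  · by_cases htr : ∀ x y, σ.SameCycle x y
    · exact Or.inr (Or.inr ⟨σ, hσ, htr⟩)
    · push Not at htr
      obtain ⟨x, y, hxy⟩ := htr
      obtain ⟨f, hf1, hf, hc, -⟩ := hsr.exists_collapse hxy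
      exact Or.inl ⟨f, hf1, hf, hc⟩
  · unfold IsSemiregular at hsr
    push Not at hsr
    obtain ⟨i, x, hx, hi⟩ := hsr
    -- A second fixed point, distinct from `x` because `a` itself fixes nothing.
    have hx' : (σ ^ i).toEnd (a x) = a x := by
      rw [← commute_iff.1 (hpow i) x, Equiv.Perm.toEnd_apply, hx]
    exact Or.inr (Or.inl ⟨(σ ^ i).toEnd, x, Equiv.Perm.toEnd_ne_one hi, hpow i, hx,
      fixableEverywhere_of_two_fixed hx hx' (hfp x).symm (σ ^ i).injective⟩)

end Upper

/-! ### Upper bound: two transitive cyclic permutations -/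

section Cyclic

variable {X : Type*}

open Function.End

theorem isSemiregular_of_transitive {σ : Equiv.Perm X} (h : ∀ x y, σ.SameCycle x y) :
    IsSemiregular σ := by
  intro i x hx
  refine Equiv.ext fun y => ?_
  obtain ⟨j, rfl⟩ := h x y
  rw [← Equiv.Perm.mul_apply, ← zpow_add, add_comm, zpow_add, Equiv.Perm.mul_apply, hx]
  rfl

theorem orderOf_eq_natCard_of_transitive [Nonempty X] {σ : Equiv.Perm X}
    (h : ∀ x y, σ.SameCycle x y) : orderOf σ = Nat.card X := by
  let x₀ := Classical.arbitrary X
  rw [← Nat.card_zpowers]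
  refine Nat.card_congr (Equiv.ofBijective
    (fun g : Subgroup.zpowers σ => (g : Equiv.Perm X) x₀) ⟨?_, ?_⟩)
  · rintro ⟨_, i, rfl⟩ ⟨_, j, rfl⟩ hij
    exact Subtype.ext ((isSemiregular_of_transitive h).zpow_eq hij)
  · intro y
    obtain ⟨i, hi⟩ := h x₀ y
    exact ⟨⟨σ ^ i, i, rfl⟩, hi⟩

theorem Equiv.Perm.SameCycle.exists_fin_pow {σ : Equiv.Perm X} {p : ℕ} (hp : 0 < p)
    (hσ : orderOf σ = p) {x y : X} (h : σ.SameCycle x y) : ∃ i : Fin p, (σ ^ (i : ℕ)) x = y := by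
  obtain ⟨i, rfl⟩ := h
  have hp' : (0 : ℤ) < p := by exact_mod_cast hp
  have h1 := Int.emod_nonneg i hp'.ne'
  have h2 := Int.emod_lt_of_pos i hp'
  refine ⟨⟨(i % p).toNat, by omega⟩, ?_⟩
  rw [← zpow_natCast, Int.toNat_of_nonneg h1, ← hσ, zpow_mod_orderOf]

theorem exists_not_sameCycle [Finite X] {σ : Equiv.Perm X} {p : ℕ} (hp : 0 < p)
    (hσ : orderOf σ = p) (hX : p < Nat.card X) (x : X) : ∃ y, ¬ σ.SameCycle x y := by
  by_contra! h
  have hs : Function.Surjective (fun i : Fin p => (σ ^ (i : ℕ)) x) := fun y =>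
    (h y).exists_fin_pow hp hσ
  have := Nat.card_le_card_of_surjective _ hs
  rw [Nat.card_fin] at this
  omega

theorem IsSemiregular.fixableEverywhere [Finite X] {σ : Equiv.Perm X} (h : IsSemiregular σ)
    {p : ℕ} (hp : 0 < p) (hσ : orderOf σ = p) (hX : p < Nat.card X) :
    FixableEverywhere σ.toEnd := by
  intro x
  obtain ⟨y, hy⟩ := exists_not_sameCycle hp hσ hX x
  obtain ⟨f, hf1, -, hc, hx⟩ := h.exists_collapse (x := y) (y := x) fun h => hy h.symm
  exact ⟨f, hf1, hc, hx⟩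

theorem exists_semiregular_pow_of_transitive [Finite X] [Nonempty X] {σ : Equiv.Perm X}
    (h : ∀ x y, σ.SameCycle x y) {p : ℕ} (hp : p.Prime) (hpX : p ∣ Nat.card X) :
    ∃ τ : Equiv.Perm X, Commute σ τ ∧ IsSemiregular τ ∧ orderOf τ = p := by
  have ho := orderOf_eq_natCard_of_transitive h
  refine ⟨σ ^ (Nat.card X / p), (Commute.refl σ).pow_right _, ?_, ?_⟩
  · intro i x hx
    rw [← zpow_natCast, ← zpow_mul] at hx ⊢
    exact isSemiregular_of_transitive h _ _ hx
  · obtain ⟨k, hk⟩ := hpX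
    have hX : 0 < Nat.card X := Nat.card_pos
    have hk0 : 0 < k := Nat.pos_of_ne_zero fun h0 => by simp [hk, h0] at hX
    rw [hk, Nat.mul_div_cancel_left _ hp.pos, orderOf_pow, ho, hk, Nat.gcd_mul_left_left,
      Nat.mul_div_cancel _ hk0]

/-- Acting by `σ` on a single orbit. -/
theorem exists_rotate_orbit {σ : Equiv.Perm X} {x : X} (hx : σ x ≠ x) :
    ∃ g : Function.End X, g ≠ 1 ∧ Commute σ.toEnd g ∧ (∀ z, σ.SameCycle x z → σ.SameCycle x (g z)) ∧
      ∀ z, ¬ σ.SameCycle x z → g z = z := by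
  classical
  refine ⟨fun z => if σ.SameCycle x z then σ z else z, ?_, ?_, ?_, ?_⟩
  · refine ne_one_of_apply_ne (x := x) ?_
    rw [if_pos (Equiv.Perm.SameCycle.refl _ _)]
    exact hx
  · refine commute_iff.2 fun z => ?_
    simp only [Equiv.Perm.toEnd_apply, Equiv.Perm.sameCycle_apply_right]
    split_ifs <;> rfl
  · intro z hz
    simp only [if_pos hz]
    exact Equiv.Perm.sameCycle_apply_right.2 hz
  · intro z hz
    exact if_neg hz

/-- If all orbits of `σ` meet all orbits of `τ` and there are at least `p ^ 2` points, the points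
form a grid, which retracts equivariantly onto the `σ`-orbit of a given point. -/
theorem exists_grid_retraction [Finite X] {σ τ : Equiv.Perm X} {p : ℕ} (hp : 0 < p)
    (hσ : orderOf σ = p) (hτ : orderOf τ = p) (hX : p * p ≤ Nat.card X)
    (hmeet : ∀ x y, ∃ z, σ.SameCycle x z ∧ τ.SameCycle y z) (x₀ : X) :
    ∃ e : Function.End X, Commute σ.toEnd e ∧ (∀ z, σ.SameCycle x₀ (e z)) ∧
      ∀ z, τ.SameCycle x₀ z → e z = x₀ := by
  let F : Fin p × Fin p → X := fun ij => (σ ^ (ij.1 : ℕ)) ((τ ^ (ij.2 : ℕ)) x₀)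
  have hsurj : Function.Surjective F := by
    intro z
    obtain ⟨w, hw1, hw2⟩ := hmeet z x₀
    obtain ⟨i, hi⟩ := hw1.symm.exists_fin_pow hp hσ
    obtain ⟨j, hj⟩ := hw2.exists_fin_pow hp hτ
    exact ⟨(i, j), by simp only [F, hj, hi]⟩
  -- A surjection from `p * p` elements onto at least that many is a bijection, so grid coordinates
  -- are unique.
  have hinj : Function.Injective F := by
    refine ((Nat.bijective_iff_surjective_and_card F).2 ⟨hsurj, ?_⟩).1
    refine le_antisymm ?_ (Nat.card_le_card_of_surjective F hsurj)
    simpa using hX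
  have hF : ∀ (i : ℤ) (j : Fin p) (i' j' : Fin p),
      (σ ^ i) ((τ ^ (j : ℕ)) x₀) = F (i', j') → σ ^ i = σ ^ (i' : ℕ) := by
    intro i j i' j' h
    have hp' : (0 : ℤ) < p := by exact_mod_cast hp
    have h1 := Int.emod_nonneg i hp'.ne'
    have h2 := Int.emod_lt_of_pos i hp'
    have h3 : σ ^ i = σ ^ (i % p).toNat := by
      rw [← zpow_natCast, Int.toNat_of_nonneg h1, ← hσ, zpow_mod_orderOf]
    rw [h3] at h ⊢
    have h4 := @hinj (⟨(i % p).toNat, by omega⟩, j) (i', j') h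
    have h5 : (i % p).toNat = (i' : ℕ) := congrArg (fun q : Fin p × Fin p => (q.1 : ℕ)) h4
    rw [h5]
  let G : X → Fin p × Fin p := fun z => (hsurj z).choose
  have hG : ∀ z, F (G z) = z := fun z => (hsurj z).choose_spec
  refine ⟨fun z => (σ ^ ((G z).1 : ℕ)) x₀, ?_, ?_, ?_⟩
  · refine commute_iff.2 fun z => ?_
    rw [Equiv.Perm.toEnd_apply, Equiv.Perm.toEnd_apply]
    have h := hF (1 + ((G z).1 : ℕ)) (G z).2 (G (σ z)).1 (G (σ z)).2 (by
      rw [zpow_one_add, Equiv.Perm.mul_apply, zpow_natCast]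
      change σ (F (G z)) = F (G (σ z))
      rw [hG, hG])
    rw [← h, zpow_one_add, Equiv.Perm.mul_apply, zpow_natCast]
  · exact fun z => ⟨((G z).1 : ℕ), by rw [zpow_natCast]⟩
  · intro z hz
    obtain ⟨j, hj⟩ := hz.exists_fin_pow hp hτ
    have h := hF 0 j (G z).1 (G z).2 (by
      rw [hj, zpow_zero]
      exact (hG z).symm)
    change (σ ^ ((G z).1 : ℕ)) x₀ = x₀
    rw [← h, zpow_zero]
    rfl

/-- If all orbits meet, the two grid retractions compose in either order to the constant `x₀`.
Otherwise two disjoint orbits are rotated independently. -/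
theorem exists_commuting_of_semiregular [Finite X] [Nonempty X] {σ τ : Equiv.Perm X} {p : ℕ}
    (hp : p.Prime) (hσs : IsSemiregular σ) (hτs : IsSemiregular τ) (hσ : orderOf σ = p)
    (hτ : orderOf τ = p) (hX : p * p ≤ Nat.card X) :
    ∃ e f : Function.End X, e ≠ 1 ∧ f ≠ 1 ∧ Commute σ.toEnd e ∧ Commute τ.toEnd f ∧
      Commute e f := by
  have hmove : ∀ ρ : Equiv.Perm X, IsSemiregular ρ → orderOf ρ = p → ∀ x, ρ x ≠ x := by
    intro ρ hρ ho x hx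
    have := hρ 1 x (by simpa using hx)
    rw [zpow_one] at this
    rw [this, orderOf_one] at ho
    exact hp.one_lt.ne ho
  by_cases hmeet : ∀ x y, ∃ z, σ.SameCycle x z ∧ τ.SameCycle y z
  · let x₀ := Classical.arbitrary X
    obtain ⟨e, he, he1, he2⟩ := exists_grid_retraction hp.pos hσ hτ hX hmeet x₀
    obtain ⟨f, hf, hf1, hf2⟩ := exists_grid_retraction hp.pos hτ hσ hX
      (fun x y => (hmeet y x).imp fun _ h => h.symm) x₀
    refine ⟨e, f, ?_, ?_, he, hf, commute_iff.2 fun z => ?_⟩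
    · refine ne_one_of_apply_ne (x := τ x₀) ?_
      rw [he2 _ ⟨1, by simp⟩]
      exact (hmove τ hτs hτ x₀).symm
    · refine ne_one_of_apply_ne (x := σ x₀) ?_
      rw [hf2 _ ⟨1, by simp⟩]
      exact (hmove σ hσs hσ x₀).symm
    · rw [he2 _ (hf1 z), hf2 _ (he1 z)]
  · push Not at hmeet
    obtain ⟨x, y, hxy⟩ := hmeet
    obtain ⟨e, he1, he, hex, hex'⟩ := exists_rotate_orbit (hmove σ hσs hσ x)
    obtain ⟨f, hf1, hf, hfy, hfy'⟩ := exists_rotate_orbit (hmove τ hτs hτ y)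
    refine ⟨e, f, he1, hf1, he, hf, commute_iff.2 fun z => ?_⟩
    by_cases hz : σ.SameCycle x z
    · rw [hfy' z (hxy z hz), hfy' _ (hxy _ (hex z hz))]
    · rw [hex' z hz]
      by_cases hz' : τ.SameCycle y z
      · rw [hex' _ fun h => hxy _ h (hfy z hz')]
      · rw [hfy' z hz', hex' z hz]

theorem commutingChain_five [Finite X] (hX : 3 ≤ Nat.card X) (hn : ¬ (Nat.card X).Prime)
    {a b : Function.End X} (ha : a ≠ 1) (hb : b ≠ 1) : CommutingChain 5 a b := by
  classical
  have : Nonempty X := (Nat.card_pos_iff.1 (by omega)).1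
  have : Nontrivial X := Finite.one_lt_card_iff_nontrivial.1 (by omega)
  have : Fintype X := Fintype.ofFinite X
  have hX' : ∀ x y : X, ∃ z, z ≠ x ∧ z ≠ y := by
    intro x y
    obtain ⟨z, hz⟩ := Finset.exists_mem_notMem_of_card_lt_card (s := {x, y}) (t := Finset.univ)
      (by rw [Finset.card_univ, ← Nat.card_eq_fintype_card]
          exact Finset.card_le_two.trans_lt (by omega))
    exact ⟨z, by simpa using hz.2⟩
  -- The least prime factor satisfies `p * p ≤ n` for composite `n`, as the grid argument requires.
  let p := (Nat.card X).minFac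
  have hp : p.Prime := Nat.minFac_prime (by omega)
  have hpp : p * p ≤ Nat.card X := by
    have := Nat.minFac_sq_le_self (by omega) hn
    rwa [sq] at this
  have hpX : p < Nat.card X := by nlinarith [hp.two_le]
  have cyc : ∀ {σ : Equiv.Perm X}, (∀ x y, σ.SameCycle x y) →
      ∃ τ : Equiv.Perm X, Commute σ.toEnd τ.toEnd ∧ IsSemiregular τ ∧ orderOf τ = p ∧
        τ.toEnd ≠ 1 ∧ FixableEverywhere τ.toEnd := by
    intro σ hσ
    obtain ⟨τ, h1, h2, h3⟩ := exists_semiregular_pow_of_transitive hσ hp (Nat.minFac_dvd _)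
    refine ⟨τ, Equiv.Perm.commute_toEnd h1, h2, h3, Equiv.Perm.toEnd_ne_one ?_,
      h2.fixableEverywhere hp.pos h3 hpX⟩
    rintro rfl
    rw [orderOf_one] at h3
    exact hp.one_lt.ne h3
  have idem : ∀ {a b b' : Function.End X}, a ≠ 1 → b ≠ 1 → CommutesWithIdempotent a → b' ≠ 1 →
      Commute b b' → FixableEverywhere b' → CommutingChain 5 a b := by
    intro a b b' _ hb ⟨e, he1, he, hae⟩ hb' hbb' hfix
    obtain ⟨x, hx⟩ := exists_apply_eq_of_isIdempotentElem he
    exact commutingChain_of_fixed_point he1 hae hx hb hb' hbb' hfix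
  rcases trichotomy ha with hA | ⟨a', x, ha', haa', hx, hfa⟩ | ⟨σ, rfl, hσ⟩
  · rcases trichotomy hb with hB | ⟨b', y, hb', hbb', hy, hfb⟩ | ⟨τ, rfl, hτ⟩
    · exact commutingChain_of_idempotents hX' hA hB hb
    · exact idem ha hb hA hb' hbb' hfb
    · obtain ⟨τ', h1, -, -, h4, h5⟩ := cyc hτ
      exact idem ha hb hA h4 h1 h5
  · rcases trichotomy hb with hB | ⟨b', y, hb', hbb', hy, hfb⟩ | ⟨τ, rfl, hτ⟩
    · exact (idem hb ha hB ha' haa' hfa).symm hb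
    · exact commutingChain_of_fixed_point ha' haa' hx hb hb' hbb' hfb
    · obtain ⟨τ', h1, -, -, h4, h5⟩ := cyc hτ
      exact commutingChain_of_fixed_point ha' haa' hx hb h4 h1 h5
  · obtain ⟨σ', h1, h2, h3, h4, h5⟩ := cyc hσ
    rcases trichotomy hb with hB | ⟨b', y, hb', hbb', hy, hfb⟩ | ⟨τ, rfl, hτ⟩
    · exact (idem hb ha hB h4 h1 h5).symm hb
    · exact (commutingChain_of_fixed_point hb' hbb' hy ha h4 h1 h5).symm hb
    · obtain ⟨τ', k1, k2, k3, k4, k5⟩ := cyc hτ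
      obtain ⟨e, f, he, hf, hσe, hτf, hef⟩ :=
        exists_commuting_of_semiregular hp h2 k2 h3 k3 hpp
      exact ⟨σ'.toEnd, h4, h1, e, he, hσe, f, hf, hef, τ'.toEnd, k4, hτf.symm, τ.toEnd, hb,
        k1.symm, rfl⟩

end Cyclic

/-! ### Lower bound: maps with a tail and a cycle, and joint centralizers -/

section Lower

open Function.End

/-- The middle element of a four-step chain would commute with both idempotent powers. -/
theorem not_commutingChain_four {X : Type*} {a b : Function.End X} {x y : X}
    (ha : IsGeneratedBy a x) (hb : IsGeneratedBy b y) {k l : ℕ}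
    (hk : IsIdempotentElem (a ^ k)) (hl : IsIdempotentElem (b ^ l))
    (h : ∀ g : Function.End X, Commute (a ^ k) g → Commute (b ^ l) g → g = 1) :
    ¬ CommutingChain 4 a b := by
  rintro ⟨g₁, hg₁, h1, g₂, hg₂, h2, g₃, hg₃, h3, c, hc, h4, rfl⟩
  exact hg₂ (h g₂ (ha.commute_idempotent_pow hk hg₁ h1 h2)
    (hb.commute_idempotent_pow hl hg₃ h4.symm h3.symm))

/-- The transformation `0 ↦ 1 ↦ ⋯ ↦ n - 1 ↦ n - r` of `Fin n`. -/
def rho (n r : ℕ) (hr : 0 < r) : Function.End (Fin n) := fun j =>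
  if h : (j : ℕ) + 1 < n then ⟨j + 1, h⟩ else ⟨n - r, by omega⟩

section Rho

variable {n r : ℕ} (hr : 0 < r)

theorem rho_pow_val_of_lt (k : ℕ) (j : Fin n) (h : (j : ℕ) + k < n) :
    (((rho n r hr ^ k) j : Fin n) : ℕ) = j + k := by
  induction k generalizing j with
  | zero => rfl
  | succ k ih =>
    have h1 : (j : ℕ) + 1 < n := by omega
    have h2 : rho n r hr j = ⟨j + 1, h1⟩ := dif_pos h1
    rw [pow_succ]
    change (((rho n r hr ^ k) (rho n r hr j) : Fin n) : ℕ) = _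
    rw [h2, ih _ (by simp only; omega)]
    simp only
    omega

theorem rho_isGeneratedBy [NeZero n] : IsGeneratedBy (rho n r hr) 0 := fun z =>
  ⟨z, Fin.ext (by rw [rho_pow_val_of_lt] <;> simp)⟩

theorem rho_pow_period_of_lt (j : Fin n) (h : (j : ℕ) + r < n) :
    (((rho n r hr ^ r) j : Fin n) : ℕ) = j + r :=
  rho_pow_val_of_lt hr r j h

theorem rho_pow_period_of_le (hrn : r ≤ n) (j : Fin n) (h : n ≤ (j : ℕ) + r) :
    (rho n r hr ^ r) j = j := by
  have hj := j.2
  obtain ⟨d, hd⟩ : ∃ d, (n - 1 - (j : ℕ)) = d := ⟨_, rfl⟩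
  -- Going once round the cycle: `d` steps up to `n - 1`, one step back to `n - r`, then up to `j`
  -- again.
  have hsplit : r = (j - (n - r)) + (1 + d) := by omega
  have h1 : (rho n r hr ^ d) j = ⟨n - 1, by omega⟩ :=
    Fin.ext ((rho_pow_val_of_lt hr d j (by omega)).trans (show (j : ℕ) + d = n - 1 by omega))
  have h2 : rho n r hr ⟨n - 1, by omega⟩ = ⟨n - r, by omega⟩ :=
    dif_neg (show ¬ n - 1 + 1 < n by omega)
  have h3 : rho n r hr ^ r = rho n r hr ^ ((j : ℕ) - (n - r)) * (rho n r hr * rho n r hr ^ d) := by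
    rw [← pow_succ', ← pow_add]
    congr 1
    omega
  rw [h3]
  change (rho n r hr ^ ((j : ℕ) - (n - r))) (rho n r hr ((rho n r hr ^ d) j)) = j
  rw [h1, h2]
  exact Fin.ext ((rho_pow_val_of_lt hr _ _ (show n - r + ((j : ℕ) - (n - r)) < n by omega)).trans
    (show n - r + ((j : ℕ) - (n - r)) = j by omega))

end Rho

/-- The joint-centralizer computation behind `exists_not_commutingChain_four`: on the points
`0, …, 2r + t - 1`, with `E` and `F` the idempotents retracting onto the last and the middle
`r` points. -/
theorem eq_self_of_commute_retractions {r t : ℕ} (hr : 3 ≤ r) (ht : t = 1 ∨ t = 2)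
    {G E F : ℕ → ℕ}
    (hG : ∀ m < 2 * r + t, G m < 2 * r + t)
    (hE1 : ∀ m < t, E m = m + 2 * r) (hE2 : ∀ m, t ≤ m → m < t + r → E m = m + r)
    (hE3 : ∀ m, t + r ≤ m → m < 2 * r + t → E m = m)
    (hF1 : ∀ m < t, F m = m + r - 1) (hF2 : ∀ m, t ≤ m → m < t + r → F m = m)
    (hF3 : ∀ m, t + r ≤ m → m < 2 * r + t - 1 → F m = m + 1 - r)
    (hF4 : F (2 * r + t - 1) = t)
    (hGE : ∀ m < 2 * r + t, G (E m) = E (G m)) (hGF : ∀ m < 2 * r + t, G (F m) = F (G m)) :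
    ∀ m < 2 * r + t, G m = m := by
  have hEr : ∀ m < 2 * r + t, t + r ≤ E m ∧ E m < 2 * r + t := by
    intro m hm
    rcases lt_or_ge m t with h | h
    · rw [hE1 m h]; omega
    · rcases lt_or_ge m (t + r) with h' | h'
      · rw [hE2 m h h']; omega
      · rw [hE3 m h' hm]; omega
  have hFr : ∀ m < 2 * r + t, t ≤ F m ∧ F m < t + r := by
    intro m hm
    rcases lt_or_ge m t with h | h
    · rw [hF1 m h]; omega
    · rcases lt_or_ge m (t + r) with h' | h'
      · rw [hF2 m h h']; omega
      · rcases lt_or_ge m (2 * r + t - 1) with h'' | h''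
        · rw [hF3 m h' h'']; omega
        · obtain rfl : m = 2 * r + t - 1 := by omega
          rw [hF4]; omega
  have hR : ∀ m, t + r ≤ m → m < 2 * r + t → t + r ≤ G m ∧ G m < 2 * r + t := by
    intro m h1 h2
    have := hGE m h2
    rw [hE3 m h1 h2] at this
    rw [this]
    exact hEr _ (hG m h2)
  have hS : ∀ m, t ≤ m → m < t + r → t ≤ G m ∧ G m < t + r := by
    intro m h1 h2
    have := hGF m (by omega)
    rw [hF2 m h1 h2] at this
    rw [this]
    exact hFr _ (hG m (by omega))
  have hSR : ∀ m, t ≤ m → m < t + r → G (m + r) = G m + r := by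
    intro m h1 h2
    have := hGE m (by omega)
    obtain ⟨h3, h4⟩ := hS m h1 h2
    rwa [hE2 m h1 h2, hE2 _ h3 h4] at this
  -- On the last block `E ∘ F` is the cyclic rotation by one, and `G` commutes with it.
  have hstep : ∀ m, t + r ≤ m → m < 2 * r + t - 1 →
      G (m + 1) = if G m < 2 * r + t - 1 then G m + 1 else t + r := by
    intro m h1 h2
    obtain ⟨h3, h4⟩ := hR m h1 (by omega)
    have h5 := hGF m (by omega)
    rw [hF3 m h1 h2] at h5
    have h6 := hSR (m + 1 - r) (by omega) (by omega)
    rw [h5, show m + 1 - r + r = m + 1 by omega] at h6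
    rw [h6]
    split_ifs with h
    · rw [hF3 _ h3 h]; omega
    · rw [show G m = 2 * r + t - 1 by omega, hF4]
  -- For `j < t`, `E j` is the rotation successor of `E (F j)`, a relation that `G` preserves. On
  -- the middle block the two are equal, and on the last block `E (F y)` is the successor of `E y`.
  -- As `r ≥ 3`, neither is compatible, so `G j < t`.
  have hT : ∀ j < t, G j < t ∧ G (j + 2 * r - 1) = G j + 2 * r - 1 := by
    intro j hj
    have hz := hG j (by omega)
    have e1 := hGE j (by omega)
    have f1 := hGF j (by omega)
    rw [hE1 j hj] at e1
    rw [hF1 j hj] at f1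
    have c1 := hSR (j + r - 1) (by omega) (by omega)
    rw [show j + r - 1 + r = j + 2 * r - 1 by omega] at c1
    have c2 := hstep (j + 2 * r - 1) (by omega) (by omega)
    rw [show j + 2 * r - 1 + 1 = j + 2 * r by omega] at c2
    have c3 := hR (j + 2 * r - 1) (by omega) (by omega)
    rcases lt_or_ge (G j) t with h | h
    · rw [hE1 _ h] at e1
      rw [hF1 _ h] at f1
      omega
    · exfalso
      rcases lt_or_ge (G j) (t + r) with h' | h'
      · rw [hE2 _ h h'] at e1
        rw [hF2 _ h h'] at f1
        split_ifs at c2 <;> omega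
      · rw [hE3 _ h' hz] at e1
        rcases lt_or_ge (G j) (2 * r + t - 1) with h'' | h''
        · rw [hF3 _ h' h''] at f1
          split_ifs at c2 <;> omega
        · rw [show G j = 2 * r + t - 1 by omega] at e1 f1
          rw [hF4] at f1
          split_ifs at c2 <;> omega
  -- One fixed point makes the rotation-equivariant `G` the identity on the last block. The
  -- alternative `G 0 = 1` needs `t = 2` and would force `G 1 = 2`.
  have hpt : G (2 * r - 1) = 2 * r - 1 := by
    obtain ⟨h0, h0'⟩ := hT 0 (by omega)
    rw [Nat.zero_add] at h0'
    rcases Nat.eq_zero_or_pos (G 0) with hz | hz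
    · rw [h0', hz, Nat.zero_add]
    · exfalso
      obtain ⟨h1, h1'⟩ := hT 1 (by omega)
      have h2 := hstep (2 * r - 1) (by omega) (by omega)
      rw [show 2 * r - 1 + 1 = 1 + 2 * r - 1 by omega, h1', h0'] at h2
      split_ifs at h2 <;> omega
  have hup : ∀ d, 2 * r - 1 + d < 2 * r + t → G (2 * r - 1 + d) = 2 * r - 1 + d := by
    intro d
    induction d with
    | zero => exact fun _ => hpt
    | succ d ih =>
      intro h
      have h1 := hstep (2 * r - 1 + d) (by omega) (by omega)
      rw [ih (by omega), if_pos (by omega)] at h1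
      exact h1
  have hdown : ∀ d, t + r + d ≤ 2 * r - 1 → G (2 * r - 1 - d) = 2 * r - 1 - d := by
    intro d
    induction d with
    | zero => exact fun _ => hpt
    | succ d ih =>
      intro h
      have h1 := hstep (2 * r - 1 - (d + 1)) (by omega) (by omega)
      have h2 := hR (2 * r - 1 - (d + 1)) (by omega) (by omega)
      rw [show 2 * r - 1 - (d + 1) + 1 = 2 * r - 1 - d by omega, ih (by omega)] at h1
      split_ifs at h1 <;> omega
  have hRfix : ∀ m, t + r ≤ m → m < 2 * r + t → G m = m := by
    intro m h1 h2
    rcases le_total m (2 * r - 1) with h | h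
    · have := hdown (2 * r - 1 - m) (by omega)
      rwa [show 2 * r - 1 - (2 * r - 1 - m) = m by omega] at this
    · have := hup (m - (2 * r - 1)) (by omega)
      rwa [show 2 * r - 1 + (m - (2 * r - 1)) = m by omega] at this
  intro m hm
  rcases lt_or_ge m t with h | h
  · obtain ⟨h1, h2⟩ := hT m h
    rw [hRfix _ (by omega) (by omega)] at h2
    omega
  · rcases lt_or_ge m (t + r) with h' | h'
    · have h1 := hSR m h h'
      rw [hRfix _ (by omega) (by omega)] at h1
      omega
    · exact hRfix m h' hm

end Lower

/-! ### Lower bound for at least seven points -/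

section LowerSeven

open Function.End

theorem rho_pow_two_period_val {n r : ℕ} (hr : 0 < r) (hrn : 2 * r ≤ n)
    (j : Fin n) :
    (((rho n r hr ^ (2 * r)) j : Fin n) : ℕ) =
      if (j : ℕ) + 2 * r < n then (j : ℕ) + 2 * r
      else if (j : ℕ) + r < n then (j : ℕ) + r else j := by
  have h1 : (rho n r hr ^ (2 * r)) j = (rho n r hr ^ r) ((rho n r hr ^ r) j) := by
    rw [two_mul, pow_add]
    rfl
  rw [h1]
  have hj := j.2
  by_cases h : (j : ℕ) + r < n
  · have h2 := rho_pow_period_of_lt hr j h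
    by_cases h' : (j : ℕ) + 2 * r < n
    · rw [if_pos h', rho_pow_period_of_lt hr _ (by omega), h2]
      omega
    · rw [if_neg h', if_pos h, rho_pow_period_of_le hr (by omega) _ (by omega), h2]
  · have h2 := rho_pow_period_of_le hr (by omega) j (by omega)
    rw [if_neg (by omega), if_neg h, h2, h2]

/-- The exponent is a multiple of the cycle length `r` and at least the tail length `n - r`. -/
theorem isIdempotentElem_rho_pow {n r : ℕ} (hr : 0 < r) (hrn : 2 * r ≤ n) (hn : n ≤ 3 * r) :
    IsIdempotentElem (rho n r hr ^ (2 * r)) := by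
  refine funext fun j => Fin.ext ?_
  change (((rho n r hr ^ (2 * r)) ((rho n r hr ^ (2 * r)) j) : Fin n) : ℕ) = _
  rw [rho_pow_two_period_val hr hrn ((rho n r hr ^ (2 * r)) j),
    rho_pow_two_period_val hr hrn j]
  have := j.2
  split_ifs <;> omega

/-- The relabelling of the points `0, …, 2r + t - 1` that is used to produce a second
transformation of the shape `rho`. -/
def relabel (r t q : ℕ) : ℕ :=
  if q < t then q
  else if q = t then t + 2 * r - 2
  else if q = t + 1 then t + 2 * r - 1
  else if q < t + r then q - 2 + r
  else if q = t + r then t + r - 1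
  else q - r - 1

theorem relabel_lt {r t q : ℕ} (hr : 3 ≤ r) (hq : q < 2 * r + t) :
    relabel r t q < 2 * r + t := by
  unfold relabel
  split_ifs <;> omega

theorem relabel_inj {r t q q' : ℕ} (hr : 3 ≤ r) (hq : q < 2 * r + t) (hq' : q' < 2 * r + t)
    (h : relabel r t q = relabel r t q') : q = q' := by
  unfold relabel at h
  split_ifs at h <;> omega

/-- `relabel` as a permutation of `Fin (2 * r + t)`. -/
noncomputable def relabelPerm {r : ℕ} (t : ℕ) (hr : 3 ≤ r) : Fin (2 * r + t) ≃ Fin (2 * r + t) :=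
  Equiv.ofBijective (fun q => ⟨relabel r t q, relabel_lt hr q.2⟩)
    (Finite.injective_iff_bijective.1 fun q q' h =>
      Fin.ext (relabel_inj hr q.2 q'.2 (congrArg Fin.val h)))

set_option maxHeartbeats 2000000 in
theorem exists_not_commutingChain_four {n : ℕ} (hn : 7 ≤ n) :
    ∃ a b : Function.End (Fin n), a ≠ 1 ∧ b ≠ 1 ∧ ¬ CommutingChain 4 a b := by
  obtain ⟨r, t, hr, ht, rfl⟩ : ∃ r t, 3 ≤ r ∧ (t = 1 ∨ t = 2) ∧ n = 2 * r + t :=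
    ⟨(n - 1) / 2, n - 2 * ((n - 1) / 2), by omega, by omega, by omega⟩
  have hr0 : 0 < r := by omega
  have : NeZero (2 * r + t) := ⟨by omega⟩
  let a := rho (2 * r + t) r hr0
  let π := relabelPerm t hr
  -- The relabelling fixes the first `t` points and exchanges the other two blocks with shifts, so
  -- that `b ^ (2 * r)` is the map `F` of `eq_self_of_commute_retractions`.
  let b := endCongr π a
  have hπ : ∀ q : Fin (2 * r + t), ((π q : Fin (2 * r + t)) : ℕ) = relabel r t q := fun _ => rfl
  have hgen : IsGeneratedBy a 0 := rho_isGeneratedBy hr0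
  have hidem : IsIdempotentElem (a ^ (2 * r)) :=
    isIdempotentElem_rho_pow hr0 (by omega) (by omega)
  have hbpow : b ^ (2 * r) = endCongr π (a ^ (2 * r)) := (map_pow _ _ _).symm
  have hidem' : IsIdempotentElem (b ^ (2 * r)) := by
    rw [hbpow]
    exact hidem.map _
  have he := rho_pow_two_period_val (n := 2 * r + t) hr0 (by omega)
  have hf : ∀ q, (b ^ (2 * r)) (π q) = π ((a ^ (2 * r)) q) := by
    intro q
    rw [hbpow, endCongr_apply, Equiv.symm_apply_apply]
  have ha1 : a ≠ 1 := by
    refine ne_one_of_apply_ne (x := 0) fun h => ?_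
    have h1 := rho_pow_val_of_lt (n := 2 * r + t) hr0 1 0 (by simp; omega)
    rw [pow_one] at h1
    have h2 : ((rho (2 * r + t) r hr0 0 : Fin (2 * r + t)) : ℕ) = ((0 : Fin (2 * r + t)) : ℕ) := congrArg Fin.val h
    omega
  have hb1 : b ≠ 1 := fun h => ha1 ((endCongr π).injective (h.trans (map_one _).symm))
  refine ⟨a, b, ha1, hb1, not_commutingChain_four hgen (hgen.conj π) hidem hidem' ?_⟩
  intro g hge hgf
  let lift : Function.End (Fin (2 * r + t)) → ℕ → ℕ := fun φ m => if h : m < 2 * r + t then (φ ⟨m, h⟩ : ℕ) else 0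
  have hlift : ∀ (φ : Function.End (Fin (2 * r + t))) (m : ℕ) (h : m < 2 * r + t),
      lift φ m = ((φ ⟨m, h⟩ : Fin (2 * r + t)) : ℕ) := fun φ m h => dif_pos h
  have hliftlt : ∀ (φ : Function.End (Fin (2 * r + t))) (m : ℕ), m < 2 * r + t → lift φ m < 2 * r + t := by
    intro φ m h
    rw [hlift φ m h]
    exact (φ ⟨m, h⟩).2
  have hcomm : ∀ φ ψ : Function.End (Fin (2 * r + t)), Commute φ ψ → ∀ m < 2 * r + t,
      lift ψ (lift φ m) = lift φ (lift ψ m) := by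
    intro φ ψ h m hm
    rw [hlift _ _ (hliftlt φ m hm), hlift _ _ (hliftlt ψ m hm)]
    simp only [hlift _ m hm, Fin.eta]
    rw [commute_iff.1 h]
  have hE : ∀ m < 2 * r + t, lift (a ^ (2 * r)) m =
      if m + 2 * r < 2 * r + t then m + 2 * r else if m + r < 2 * r + t then m + r else m := by
    intro m hm
    rw [hlift _ _ hm]
    exact he ⟨m, hm⟩
  have hF : ∀ q < 2 * r + t, lift (b ^ (2 * r)) (relabel r t q) = relabel r t
      (if q + 2 * r < 2 * r + t then q + 2 * r else if q + r < 2 * r + t then q + r else q) := by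
    intro q hq
    have h1 : relabel r t q < 2 * r + t := relabel_lt hr hq
    rw [hlift _ _ h1]
    have h2 : (⟨relabel r t q, h1⟩ : Fin (2 * r + t)) = π ⟨q, hq⟩ := rfl
    rw [h2, hf, hπ]
    exact congrArg _ (he ⟨q, hq⟩)
  have hF' : ∀ q < 2 * r + t, ∀ m k, relabel r t q = m → relabel r t
      (if q + 2 * r < 2 * r + t then q + 2 * r else if q + r < 2 * r + t then q + r else q) = k →
      lift (b ^ (2 * r)) m = k := by
    rintro q hq m k rfl rfl
    exact hF q hq
  have key := eq_self_of_commute_retractions hr ht (G := lift g) (E := lift (a ^ (2 * r)))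
    (F := lift (b ^ (2 * r)))
    (fun m hm => hliftlt g m hm)
    (fun m hm => by rw [hE m (by omega)]; split_ifs <;> omega)
    (fun m h1 h2 => by rw [hE m (by omega)]; split_ifs <;> omega)
    (fun m h1 h2 => by rw [hE m (by omega)]; split_ifs <;> omega)
    (fun m hm => hF' m (by omega) _ _ (by unfold relabel; split_ifs <;> omega)
      (by unfold relabel; split_ifs <;> omega))
    (fun m h1 h2 => by
      rcases eq_or_ne m (t + r - 1) with h | h
      · exact hF' (t + r) (by omega) _ _ (by unfold relabel; split_ifs <;> omega)
          (by unfold relabel; split_ifs <;> omega)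
      · exact hF' (m + r + 1) (by omega) _ _ (by unfold relabel; split_ifs <;> omega)
          (by unfold relabel; split_ifs <;> omega))
    (fun m h1 h2 => by
      rcases eq_or_ne m (t + 2 * r - 2) with h | h
      · exact hF' t (by omega) _ _ (by unfold relabel; split_ifs <;> omega)
          (by unfold relabel; split_ifs <;> omega)
      · exact hF' (m + 2 - r) (by omega) _ _ (by unfold relabel; split_ifs <;> omega)
          (by unfold relabel; split_ifs <;> omega))
    (hF' (t + 1) (by omega) _ _ (by unfold relabel; split_ifs <;> omega)
      (by unfold relabel; split_ifs <;> omega))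
    (fun m hm => hcomm _ _ hge m (by omega))
    (fun m hm => hcomm _ _ hgf m (by omega))
  refine funext fun m => Fin.ext ?_
  have := key m m.2
  rw [hlift _ _ m.2] at this
  exact this

end LowerSeven

/-! ### Lower bound for six points -/

section LowerSix

open Function.End

/-- A cyclic permutation of six points. -/
def sixCycle : Function.End (Fin 6) := ![2, 5, 3, 4, 1, 0]

theorem sixCycle_isGeneratedBy : IsGeneratedBy sixCycle 0 := by
  have : ∀ z : Fin 6, ∃ i : Fin 6, (sixCycle ^ (i : ℕ)) 0 = z := by decide
  intro z
  obtain ⟨i, hi⟩ := this z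
  exact ⟨i, hi⟩

theorem sixCycle_pow_six : sixCycle ^ 6 = 1 := by
  have : ∀ z : Fin 6, (sixCycle ^ 6) z = z := by decide
  exact funext this

/-- As `k` is not divisible by 6, some multiple of it is 2 or 3 modulo 6. -/
theorem commute_pow_two_or_three {M : Type*} [Monoid M] {a g : M} (h6 : a ^ 6 = 1) {k : ℕ}
    (hk : a ^ k ≠ 1) (h : Commute (a ^ k) g) : Commute (a ^ 2) g ∨ Commute (a ^ 3) g := by
  have hmod : ∀ m, a ^ m = a ^ (m % 6) := fun m => by
    conv_lhs => rw [← Nat.div_add_mod m 6, pow_add, pow_mul, h6, one_pow, one_mul]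
  have key : ∀ m j, (k * m) % 6 = j → Commute (a ^ j) g := by
    rintro m j rfl
    rw [← hmod, pow_mul]
    exact h.pow_left m
  have hk0 : k % 6 ≠ 0 := fun h0 => hk (by rw [hmod, h0, pow_zero])
  have : k % 6 < 6 := Nat.mod_lt _ (by norm_num)
  have cases : k % 6 = 1 ∨ k % 6 = 2 ∨ k % 6 = 3 ∨ k % 6 = 4 ∨ k % 6 = 5 := by omega
  rcases cases with h | h | h | h | h
  · exact Or.inl (key 2 2 (by omega))
  · exact Or.inl (key 1 2 (by omega))
  · exact Or.inr (key 1 3 (by omega))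
  · exact Or.inl (key 2 2 (by omega))
  · exact Or.inl (key 4 2 (by omega))

theorem forall_fin_six {P : Fin 6 → Prop} (h0 : P 0) (h1 : P 1) (h2 : P 2) (h3 : P 3) (h4 : P 4)
    (h5 : P 5) (z : Fin 6) : P z := by
  fin_cases z <;> assumption

/-- The idempotent power of `rho 6 3`. -/
def foldThree : Function.End (Fin 6) := ![3, 4, 5, 3, 4, 5]

theorem end_fin_six_ext {f g : Function.End (Fin 6)} (h : ∀ z : Fin 6, @Eq (Fin 6) (f z) (g z)) :
    f = g :=
  funext h

theorem rho_six_pow_three : rho 6 3 (by norm_num) ^ 3 = foldThree :=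
  end_fin_six_ext (forall_fin_six rfl rfl rfl rfl rfl rfl)

theorem isIdempotentElem_foldThree : IsIdempotentElem foldThree :=
  end_fin_six_ext (forall_fin_six rfl rfl rfl rfl rfl rfl)

theorem eq_one_of_commute_sixCycle_pow_two {g : Function.End (Fin 6)}
    (h : Commute (sixCycle ^ 2) g) (he : Commute foldThree g) : g = 1 := by
  rw [commute_iff] at h he
  let p : Fin 6 → Fin 6 := ![3, 0, 4, 1, 5, 2]
  let e : Fin 6 → Fin 6 := ![3, 4, 5, 3, 4, 5]
  -- The orbits of `p` are `{0, 3, 1}` and `{2, 4, 5}`, so `x = g 0` and `y = g 2` determine `g`.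
  have key : ∀ x y : Fin 6, e x = p x → e (p (p x)) = p y → e y = p (p y) → x = 0 ∧ y = 2 := by
    decide
  have hp : ∀ z : Fin 6, ((sixCycle ^ 2) z : Fin 6) = p z := by decide
  have hg : ∀ z : Fin 6, (g (p z) : Fin 6) = p (g z) := fun z => by
    rw [← hp, ← hp]
    exact (h z).symm
  have hge : ∀ z : Fin 6, (g (e z) : Fin 6) = e (g z) := fun z => (he z).symm
  have g3 : (g (3 : Fin 6) : Fin 6) = p (g (0 : Fin 6)) := hg 0
  have g1 : (g (1 : Fin 6) : Fin 6) = p (g (3 : Fin 6)) := hg 3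
  have g4 : (g (4 : Fin 6) : Fin 6) = p (g (2 : Fin 6)) := hg 2
  have g5 : (g (5 : Fin 6) : Fin 6) = p (g (4 : Fin 6)) := hg 4
  have e0 : (g (3 : Fin 6) : Fin 6) = e (g (0 : Fin 6)) := hge 0
  have e1 : (g (4 : Fin 6) : Fin 6) = e (g (1 : Fin 6)) := hge 1
  have e2 : (g (5 : Fin 6) : Fin 6) = e (g (2 : Fin 6)) := hge 2
  obtain ⟨h0, h2⟩ := key (g (0 : Fin 6)) (g (2 : Fin 6)) (e0.symm.trans g3)
    (by rw [← g3, ← g1, ← e1, g4]) (by rw [← e2, g5, g4])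
  rw [h0] at g3
  rw [g3] at g1
  rw [h2] at g4
  rw [g4] at g5
  exact end_fin_six_ext (forall_fin_six h0 g1 h2 g3 g4 g5)

theorem eq_one_of_commute_sixCycle_pow_three {g : Function.End (Fin 6)}
    (h : Commute (sixCycle ^ 3) g) (he : Commute foldThree g) : g = 1 := by
  rw [commute_iff] at h he
  let p : Fin 6 → Fin 6 := ![4, 2, 1, 5, 0, 3]
  let e : Fin 6 → Fin 6 := ![3, 4, 5, 3, 4, 5]
  -- The orbits of `p` are `{0, 4}`, `{1, 2}` and `{3, 5}`, so `g 0`, `g 1` and `g 3` determine `g`.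
  have key : ∀ x y z : Fin 6, e x = z → e y = p x → e (p y) = p z → x = 0 ∧ y = 1 ∧ z = 3 := by
    decide
  have hp : ∀ z : Fin 6, ((sixCycle ^ 3) z : Fin 6) = p z := by decide
  have hg : ∀ z : Fin 6, (g (p z) : Fin 6) = p (g z) := fun z => by
    rw [← hp, ← hp]
    exact (h z).symm
  have hge : ∀ z : Fin 6, (g (e z) : Fin 6) = e (g z) := fun z => (he z).symm
  have g4 : (g (4 : Fin 6) : Fin 6) = p (g (0 : Fin 6)) := hg 0
  have g2 : (g (2 : Fin 6) : Fin 6) = p (g (1 : Fin 6)) := hg 1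
  have g5 : (g (5 : Fin 6) : Fin 6) = p (g (3 : Fin 6)) := hg 3
  have e0 : (g (3 : Fin 6) : Fin 6) = e (g (0 : Fin 6)) := hge 0
  have e1 : (g (4 : Fin 6) : Fin 6) = e (g (1 : Fin 6)) := hge 1
  have e2 : (g (5 : Fin 6) : Fin 6) = e (g (2 : Fin 6)) := hge 2
  obtain ⟨h0, h1, h3⟩ := key (g (0 : Fin 6)) (g (1 : Fin 6)) (g (3 : Fin 6)) e0.symm
    (by rw [← e1, g4]) (by rw [← g2, ← e2, g5])
  rw [h0] at g4
  rw [h1] at g2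
  rw [h3] at g5
  exact end_fin_six_ext (forall_fin_six h0 h1 g2 h3 g4 g5)

theorem exists_not_commutingChain_four_six :
    ∃ a b : Function.End (Fin 6), a ≠ 1 ∧ b ≠ 1 ∧ ¬ CommutingChain 4 a b := by
  have hidem : IsIdempotentElem (rho 6 3 (by norm_num) ^ 3) := by
    rw [rho_six_pow_three]
    exact isIdempotentElem_foldThree
  have hb : rho 6 3 (by norm_num) ≠ 1 :=
    ne_one_of_apply_ne (x := (0 : Fin 6)) (by decide : (rho 6 3 _ 0 : Fin 6) ≠ 0)
  refine ⟨sixCycle, rho 6 3 (by norm_num),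
    ne_one_of_apply_ne (x := (0 : Fin 6)) (by decide : (sixCycle 0 : Fin 6) ≠ 0), hb, ?_⟩
  rintro ⟨g₁, hg₁, h1, g₂, hg₂, h2, g₃, hg₃, h3, c, hc, h4, rfl⟩
  have he := (rho_isGeneratedBy (n := 6) (r := 3) (by norm_num)).commute_idempotent_pow hidem hg₃
    h4.symm h3.symm
  rw [rho_six_pow_three] at he
  obtain ⟨k, rfl⟩ := sixCycle_isGeneratedBy.exists_pow_eq h1
  rcases commute_pow_two_or_three sixCycle_pow_six hg₁ h2 with h | h
  · exact hg₂ (eq_one_of_commute_sixCycle_pow_two h he)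
  · exact hg₂ (eq_one_of_commute_sixCycle_pow_three h he)

end LowerSix

/-! ### Four points: the diameter by finite check and an explicit pair -/

section Four

open Function.End

/-- The value at `i` of the transformation of `{0, 1, 2, 3}` whose base-four digits are those
of `c`. -/
def codeApply (c i : ℕ) : ℕ := c / 4 ^ i % 4

/-- The transformation of `Fin 4` with a given code. -/
def decode (c : ℕ) : Function.End (Fin 4) := fun i => ⟨codeApply c i, Nat.mod_lt _ (by norm_num)⟩

/-- Whether two codes give commuting transformations. -/
def codeComm (c d : ℕ) : Bool :=
  (List.range 4).all fun i => codeApply c (codeApply d i) == codeApply d (codeApply c i)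

/-- Whether a code gives a transformation other than `1`. -/
def codeNontrivial (c : ℕ) : Bool := (List.range 4).any fun i => !(codeApply c i == i)

theorem commute_decode {c d : ℕ} (h : codeComm c d = true) : Commute (decode c) (decode d) := by
  refine commute_iff.2 fun i => Fin.ext ?_
  rw [codeComm, List.all_eq_true] at h
  exact beq_iff_eq.1 (h i (List.mem_range.2 i.2))

theorem decode_ne_one_iff {c : ℕ} : decode c ≠ 1 ↔ codeNontrivial c = true := by
  rw [codeNontrivial, List.any_eq_true]
  constructor
  · intro h
    obtain ⟨i, hi⟩ := exists_apply_ne h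
    exact ⟨i, List.mem_range.2 i.2, by
      have hne : codeApply c i ≠ i := fun h' => hi (Fin.ext h')
      simpa using hne⟩
  · rintro ⟨i, hi, h⟩ h1
    have h2 : ((decode c (⟨i, List.mem_range.1 hi⟩ : Fin 4) : Fin 4) : ℕ) = i := by rw [h1]; rfl
    have h3 : codeApply c i = i := h2
    simp [h3] at h

theorem exists_code (f : Function.End (Fin 4)) : ∃ c < 256, f = decode c := by
  have key : ∀ x y z w : Fin 4,
      codeApply (x + 4 * y + 16 * z + 64 * w) 0 = x ∧ codeApply (x + 4 * y + 16 * z + 64 * w) 1 = y ∧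
      codeApply (x + 4 * y + 16 * z + 64 * w) 2 = z ∧
      codeApply (x + 4 * y + 16 * z + 64 * w) 3 = w := by
    intro x y z w
    simp only [codeApply]
    omega
  let v : Fin 4 → Fin 4 := f
  obtain ⟨h0, h1, h2, h3⟩ := key (v 0) (v 1) (v 2) (v 3)
  refine ⟨v 0 + 4 * v 1 + 16 * v 2 + 64 * v 3, by omega, funext fun (i : Fin 4) => Fin.ext ?_⟩
  change ((v i : Fin 4) : ℕ) = codeApply _ i
  fin_cases i
  · exact h0.symm
  · exact h1.symm
  · exact h2.symm
  · exact h3.symm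

/-- Codes of the constants, the idempotents of rank three, the idempotents of rank two with two
fibres of size two, and the fixed-point-free involutions. -/
def hubCodes : List ℕ :=
  [0, 160, 224, 240, 68, 196, 20, 212, 36, 100, 164, 244, 40, 232, 204, 236, 177, 85, 165, 229,
    245, 102, 230, 170, 78, 238, 215, 231, 27, 235, 255]

/-- Codes of transformations connecting the hubs pairwise. -/
def linkCodes : List ℕ :=
  [0, 85, 170, 255, 177, 78, 27, 224, 164, 245, 160, 240, 165, 68, 238, 40, 204, 198, 102, 215, 20,
    216, 39, 235, 180, 108, 225]

theorem exists_hubCode : ((List.range 256).all fun c => !codeNontrivial c ||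
    hubCodes.any fun h => codeNontrivial h && codeComm c h) = true := by
  decide +kernel

theorem exists_linkCode : (hubCodes.all fun h => hubCodes.all fun k =>
    linkCodes.any fun m => codeNontrivial m && (codeComm h m && codeComm m k)) = true := by
  decide +kernel

theorem exists_hub {f : Function.End (Fin 4)} (hf : f ≠ 1) :
    ∃ h ∈ hubCodes, decode h ≠ 1 ∧ Commute f (decode h) := by
  obtain ⟨c, hc, rfl⟩ := exists_code f
  have h1 := List.all_eq_true.1 exists_hubCode c (List.mem_range.2 hc)
  rw [decode_ne_one_iff.1 hf, Bool.not_true, Bool.false_or, List.any_eq_true] at h1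
  obtain ⟨h, hh, h2⟩ := h1
  rw [Bool.and_eq_true] at h2
  exact ⟨h, hh, decode_ne_one_iff.2 h2.1, commute_decode h2.2⟩

theorem commutingChain_four_of_fin_four {a b : Function.End (Fin 4)} (ha : a ≠ 1) (hb : b ≠ 1) :
    CommutingChain 4 a b := by
  obtain ⟨h, hh, hh1, hah⟩ := exists_hub ha
  obtain ⟨k, hk, hk1, hbk⟩ := exists_hub hb
  have h1 := List.all_eq_true.1 (List.all_eq_true.1 exists_linkCode h hh) k hk
  obtain ⟨m, -, h2⟩ := List.any_eq_true.1 h1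
  rw [Bool.and_eq_true, Bool.and_eq_true] at h2
  exact ⟨_, hh1, hah, decode m, decode_ne_one_iff.2 h2.1, commute_decode h2.2.1, _, hk1,
    commute_decode h2.2.2, b, hb, hbk.symm, rfl⟩

theorem IsGeneratedBy.eq_one_of_commute_of_fixed {X : Type*} {a g : Function.End X} {x : X}
    (ha : IsGeneratedBy a x) (hag : Commute a g) (hg : g x = x) : g = 1 := by
  refine funext fun z => ?_
  obtain ⟨i, rfl⟩ := ha z
  rw [← commute_iff.1 (hag.pow_left i), hg]
  rfl

/-- The cube of `b` is the constant 3, so `g₁` would fix 3; but `g₁` commutes with the 4-cycle `a`,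
hence would be 1. -/
theorem exists_not_commutingChain_three :
    ∃ a b : Function.End (Fin 4), a ≠ 1 ∧ b ≠ 1 ∧ ¬ CommutingChain 3 a b := by
  let a := rho 4 4 (by norm_num)
  let b := rho 4 1 (by norm_num)
  have ha : IsGeneratedBy a (3 : Fin 4) := by
    have : ∀ z : Fin 4, ∃ i : Fin 4, @Eq (Fin 4) ((a ^ (i : ℕ)) (3 : Fin 4)) z := by decide
    intro z
    obtain ⟨i, hi⟩ := this z
    exact ⟨i, hi⟩
  have hb3 : b ^ 3 = constEnd (3 : Fin 4) :=
    funext fun z : Fin 4 => by fin_cases z <;> rfl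
  have hidem : IsIdempotentElem (b ^ 3) := by
    rw [hb3]
    rfl
  have ha1 : a ≠ 1 := ne_one_of_apply_ne (x := (0 : Fin 4))
    (by decide : ¬ @Eq (Fin 4) (a (0 : Fin 4)) 0)
  have hb1 : b ≠ 1 := ne_one_of_apply_ne (x := (0 : Fin 4))
    (by decide : ¬ @Eq (Fin 4) (b (0 : Fin 4)) 0)
  refine ⟨a, b, ha1, hb1, ?_⟩
  rintro ⟨g₁, hg₁, h1, g₂, hg₂, h2, c, hc, h3, rfl⟩
  have h4 := (rho_isGeneratedBy (n := 4) (r := 1) (by norm_num)).commute_idempotent_pow hidem hg₂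
    h3.symm h2.symm
  have h5 : Commute (b ^ 3) g₁ := h4
  rw [hb3] at h5
  exact hg₁ (ha.eq_one_of_commute_of_fixed h1 (apply_eq_of_commute_constEnd h5.symm))

end Four

/-! ### Prime degree: disconnectedness -/

section Prime

open Function.End

/-- Since `i` is invertible modulo `p`, `a` is a power of `a ^ i`; the next element therefore
commutes with `a` and is again a power of it. -/
theorem IsGeneratedBy.exists_pow_eq_of_commutingChain {X : Type*} {a b : Function.End X} {x : X}
    (ha : IsGeneratedBy a x) {p : ℕ} (hp : p.Prime) (hap : a ^ p = 1) {i : ℕ} (hi : a ^ i ≠ 1)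
    {k : ℕ} (h : CommutingChain k (a ^ i) b) : ∃ j : ℕ, b = a ^ j := by
  induction k generalizing i with
  | zero => exact ⟨i, Eq.symm h⟩
  | succ k ih =>
    obtain ⟨c, hc, hac, h⟩ := h
    have hcop : Nat.Coprime i p := by
      refine ((Nat.Prime.coprime_iff_not_dvd hp).2 ?_).symm
      rintro ⟨m, rfl⟩
      exact hi (by rw [pow_mul, hap, one_pow])
    obtain ⟨m, -, hm⟩ := Nat.exists_mul_mod_eq_one_of_coprime hcop hp.one_lt
    have h1 : (a ^ i) ^ m = a := by
      rw [← pow_mul, ← Nat.div_add_mod (i * m) p, hm, pow_add, pow_mul, hap, one_pow, one_mul,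
        pow_one]
    have h2 : Commute a c := by
      rw [← h1]
      exact hac.pow_left m
    obtain ⟨j, rfl⟩ := ha.exists_pow_eq h2
    exact ih hc h

theorem not_connected_commutingGraph_of_prime {X : Type*} {n : ℕ} (hn : n.Prime) (u : Fin n ≃ X) :
    ¬ (commutingGraph (FullTransformation X)).Connected := by
  have : NeZero n := ⟨hn.ne_zero⟩
  have : Nontrivial (Fin n) := Fin.nontrivial_iff_two_le.2 hn.two_le
  have : Nontrivial X := u.symm.nontrivial
  let c := rho n n hn.pos
  let a : Function.End X := endCongr u c
  have hgen : IsGeneratedBy a (u 0) := (rho_isGeneratedBy hn.pos).conj u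
  have hcn : c ^ n = 1 := funext fun z => rho_pow_period_of_le hn.pos le_rfl z (by omega)
  have han : a ^ n = 1 := by rw [← map_pow, hcn, map_one]
  have ha0 : a (u 0) ≠ u 0 := by
    intro h
    have h0 : a (u 0) = u (c (u.symm (u 0))) := rfl
    rw [h0, Equiv.symm_apply_apply] at h
    have h1 := rho_pow_val_of_lt (n := n) hn.pos 1 0 (by simpa using hn.one_lt)
    rw [pow_one] at h1
    have h2 : ((rho n n hn.pos 0 : Fin n) : ℕ) = ((0 : Fin n) : ℕ) :=
      congrArg Fin.val (u.injective h)
    omega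
  have ha1 : a ≠ 1 := ne_one_of_apply_ne ha0
  intro hcon
  obtain ⟨p⟩ := hcon.preconnected ⟨a, fun h => ha1 ((mem_center_end_iff a).1 h)⟩
    ⟨constEnd (u 0), fun h => constEnd_ne_one (u 0) ((mem_center_end_iff _).1 h)⟩
  have hch := commutingChain_of_walk mem_center_end_iff p le_rfl
  obtain ⟨j, hj⟩ := hgen.exists_pow_eq_of_commutingChain hn han (i := 1) (by rwa [pow_one])
    (by rw [pow_one]; exact hch)
  refine ha0 (apply_eq_of_commute_constEnd ?_)
  change constEnd (u 0) = a ^ j at hj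
  rw [hj]
  exact (Commute.refl a).pow_right j

end Prime

/-! ### Transport to an arbitrary finite set and conclusion -/

theorem le_ediam_of_not_commutingChain {X Y : Type*} (u : X ≃ Y) {k : ℕ}
    (h : ∃ a b : Function.End X, a ≠ 1 ∧ b ≠ 1 ∧ ¬ CommutingChain k a b) :
    ((k + 1 : ℕ) : ℕ∞) ≤ (commutingGraph (FullTransformation Y)).ediam := by
  obtain ⟨a, b, ha, hb, hab⟩ := h
  rw [Nat.cast_add_one]
  refine Order.add_one_le_of_lt (lt_of_not_ge fun hle => hab ?_)
  have h1 := (ediam_commutingGraph_le_iff mem_center_end_iff k).1 hle (endCongr u a) (endCongr u b)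
    (by simpa using ha) (by simpa using hb)
  simpa using h1.map (endCongr u).symm

theorem mainTheorem7 {X : Type*} [Fintype X] (n : ℕ) (hX : Fintype.card X = n) (hn : 2 ≤ n) :
    (n.Prime → ¬ (commutingGraph (FullTransformation X)).Connected) ∧
    (n = 4 → (commutingGraph (FullTransformation X)).ediam = 4) ∧
    (6 ≤ n → ¬ n.Prime → (commutingGraph (FullTransformation X)).ediam = 5) := by
  let u : Fin n ≃ X := (Fintype.equivFinOfCardEq hX).symm
  refine ⟨fun hp => not_connected_commutingGraph_of_prime hp u, ?_, ?_⟩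
  · intro h4
    clear_value u
    subst h4
    refine le_antisymm ?_ (le_ediam_of_not_commutingChain u exists_not_commutingChain_three)
    refine (ediam_commutingGraph_le_iff mem_center_end_iff 4).2 fun a b ha hb => ?_
    have h := commutingChain_four_of_fin_four (a := (endCongr u).symm a)
      (b := (endCongr u).symm b) (by simpa using ha) (by simpa using hb)
    simpa using h.map (endCongr u)
  · intro h6 hp
    refine le_antisymm ?_ (le_ediam_of_not_commutingChain (k := 4) u ?_)
    · have hcard : Nat.card X = n := by rw [Nat.card_eq_fintype_card, hX]
      exact (ediam_commutingGraph_le_iff mem_center_end_iff 5).2 fun a b ha hb =>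
        commutingChain_five (by omega) (by rwa [hcard]) ha hb
    · clear_value u
      rcases h6.eq_or_lt with rfl | h7
      · exact exists_not_commutingChain_four_six
      · exact exists_not_commutingChain_four h7
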